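/- **Definitions.** A polytope is the convex hull of a finite nonempty set of points in $\mathbb{R}^d$. Its faces are the nonempty subsets on which some linear functional attains its maximum over the polytope (the polytope itself included), and the face poset is the set of faces ordered by inclusion. For a face $F$ let $\operatorname{lin}(F)$ be the linear subspace parallel to the affine hull of $F$, with $\dim F=\dim\operatorname{lin}(F)$; two faces $F,G$ are *parallel* if $\operatorname{lin}(F)=\operatorname{lin}(G)$. Facets are the faces of codimension one. A $d$-dimensional polytope in $\mathbb{R}^d$ is *smooth* if each vertex lies on exactly $d$ edges, and at each vertex the primitive edge directions (the smallest nonzero vectors of $\mathbb{Z}^d$ pointing from the vertex along its incident edges) form a basis of the lattice $\mathbb{Z}^d$. A $d$-dimensional *combinatorial cube* is a $d$-dimensional polytope $C\subset\mathbb{R}^d$ whose face poset is isomorphic to that of $[0,1]^d$. Given such an isomorphism $\varphi$, the facets $\varphi(\{x\in[0,1]^d: x_i=0\})$ and $\varphi(\{x\in[0,1]^d: x_i=1\})$ of $C$, for $1\le i\le d$, are called *opposite*. A $d$-dimensional *prismatoid* is a $d$-dimensional polytope $P$ for which there are a $(d-1)$-dimensional polytope $Q$ and an isomorphism from the face poset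 of $Q\times[0,1]$ to that of $P$ such that the faces of $P$ corresponding to $Q\times\{1\}$ and $Q\times\{0\}$ are parallel. **Theorem.** Let $d\ge 2$ and let $C\subset\mathbb{R}^d$ be a $d$-dimensional smooth combinatorial cube. Then, for every isomorphism $\varphi$ from the face poset of $[0,1]^d$ to that of $C$, some pair of opposite facets of $C$ is parallel. In particular, $C$ is a prismatoid. -/

import Mathlib

namespace SmoothCube

section General

variable {E : Type*} [AddCommGroup E] [Module ℝ E] [TopologicalSpace E]

/-- A (nonempty) convex polytope: the convex hull of a finite nonempty set of points. -/
def IsPolytope (P : Set E) : Prop :=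
  ∃ S : Set E, S.Finite ∧ S.Nonempty ∧ P = convexHull ℝ S

/-- A nonempty face of `P`: the set of points of `P` at which some linear functional attains its
maximum over `P`. The zero functional yields `P` itself. -/
def IsFace (P F : Set E) : Prop :=
  F.Nonempty ∧ IsExposed ℝ P F

/-- The poset of nonempty faces of `P`, ordered by inclusion. -/
abbrev FacePoset (P : Set E) : Type _ :=
  {F : Set E // IsFace P F}

/-- `lin F`: the linear subspace of differences of points of the affine hull of `F`. -/
def lin (F : Set E) : Submodule ℝ E :=
  vectorSpan ℝ F

/-- The dimension of a (nonempty) convex set. -/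
noncomputable def dim (F : Set E) : ℕ :=
  Module.finrank ℝ (lin F)

/-- Two faces are parallel when they have the same direction space. -/
def Parallel (F G : Set E) : Prop :=
  lin F = lin G

/-- A facet is a face of codimension one. -/
def IsFacet (P F : Set E) : Prop :=
  IsFace P F ∧ dim F + 1 = dim P

/-- A vertex is (the point of) a zero-dimensional face. -/
def IsVertex (P : Set E) (v : E) : Prop :=
  IsFace P {v}

/-- An edge is a one-dimensional face. -/
def IsEdge (P F : Set E) : Prop :=
  IsFace P F ∧ dim F = 1

/-- A polytope is simple if every vertex lies on exactly `dim P` edges. -/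
def IsSimple (P : Set E) : Prop :=
  ∀ v, IsVertex P v → {F : Set E | IsEdge P F ∧ v ∈ F}.ncard = dim P

end General

/-- The integer vector `u`, viewed in `ℝ^d`. -/
def toReal {d : ℕ} (u : Fin d → ℤ) : Fin d → ℝ :=
  fun i => (u i : ℝ)

/-- `u ∈ ℤ^d` is a primitive edge direction of `P` at the vertex `v`: it points from `v` along an
edge of `P` containing `v`, and it is the smallest nonzero integer vector on its ray. -/
def IsPrimitiveEdgeDirection {d : ℕ} (P : Set (Fin d → ℝ)) (v : Fin d → ℝ)
    (u : Fin d → ℤ) : Prop :=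
  u ≠ 0 ∧
  (∃ F, IsEdge P F ∧ v ∈ F ∧ ∃ t : ℝ, 0 < t ∧ v + t • toReal u ∈ F) ∧
  ∀ (w : Fin d → ℤ) (s : ℝ), 0 < s → toReal w = s • toReal u → 1 ≤ s

/-- A polytope in `ℝ^d` is smooth if it is simple and at each vertex the primitive edge directions
form a basis of the lattice `ℤ^d`. (If some edge at `v` has no integer direction, simplicity
leaves fewer than `d` primitive edge directions at `v`, and the condition fails.) -/
def IsSmooth {d : ℕ} (P : Set (Fin d → ℝ)) : Prop :=
  IsSimple P ∧
  ∀ v, IsVertex P v →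
    LinearIndependent ℤ
      (Subtype.val : {u : Fin d → ℤ // IsPrimitiveEdgeDirection P v u} → (Fin d → ℤ)) ∧
    Submodule.span ℤ {u : Fin d → ℤ | IsPrimitiveEdgeDirection P v u} = ⊤

/-- The unit cube `[0,1]^d`. -/
def unitCube (d : ℕ) : Set (Fin d → ℝ) :=
  {x | ∀ k, 0 ≤ x k ∧ x k ≤ 1}

theorem isFace_unitCube_lower {d : ℕ} (i : Fin d) :
    IsFace (unitCube d) {x | x ∈ unitCube d ∧ x i = 0} := by
  have h0 : (0 : Fin d → ℝ) ∈ unitCube d := fun k => by simp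
  refine ⟨⟨0, h0, rfl⟩, fun _ => ⟨-(ContinuousLinearMap.proj i), ?_⟩⟩
  ext x
  simp only [Set.mem_ofPred_eq, neg_apply, ContinuousLinearMap.proj_apply]
  constructor
  · rintro ⟨hx, hi⟩
    exact ⟨hx, fun y hy => by rw [hi]; linarith [(hy i).1]⟩
  · rintro ⟨hx, h⟩
    refine ⟨hx, le_antisymm ?_ (hx i).1⟩
    have := h 0 h0
    simpa using this

theorem isFace_unitCube_upper {d : ℕ} (i : Fin d) :
    IsFace (unitCube d) {x | x ∈ unitCube d ∧ x i = 1} := by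
  have h1 : (1 : Fin d → ℝ) ∈ unitCube d := fun k => by simp
  refine ⟨⟨1, h1, rfl⟩, fun _ => ⟨ContinuousLinearMap.proj i, ?_⟩⟩
  ext x
  simp only [Set.mem_ofPred_eq, ContinuousLinearMap.proj_apply]
  constructor
  · rintro ⟨hx, hi⟩
    exact ⟨hx, fun y hy => by rw [hi]; exact (hy i).2⟩
  · rintro ⟨hx, h⟩
    refine ⟨hx, le_antisymm (hx i).2 ?_⟩
    have := h 1 h1
    simpa using this

/-- The facet `x i = 0` of the unit cube. -/
def lowerFacet {d : ℕ} (i : Fin d) : FacePoset (unitCube d) :=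
  ⟨{x | x ∈ unitCube d ∧ x i = 0}, isFace_unitCube_lower i⟩

/-- The facet `x i = 1` of the unit cube, opposite to `lowerFacet i`. -/
def upperFacet {d : ℕ} (i : Fin d) : FacePoset (unitCube d) :=
  ⟨{x | x ∈ unitCube d ∧ x i = 1}, isFace_unitCube_upper i⟩

/-- A `d`-dimensional combinatorial cube in `ℝ^d`: a `d`-dimensional polytope whose face poset is
isomorphic to that of `[0,1]^d`. -/
def IsCombinatorialCube (d : ℕ) (C : Set (Fin d → ℝ)) : Prop :=
  IsPolytope C ∧ dim C = d ∧ Nonempty (FacePoset (unitCube d) ≃o FacePoset C)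

/-- `F` and `G` are opposite facets of the combinatorial cube `C`, under the labelling `φ` of the
faces of `C` by the faces of the unit cube. -/
def AreOpposite {d : ℕ} {C : Set (Fin d → ℝ)} (φ : FacePoset (unitCube d) ≃o FacePoset C)
    (F G : Set (Fin d → ℝ)) : Prop :=
  IsFacet C F ∧ IsFacet C G ∧ ∃ i : Fin d, F = φ (lowerFacet i) ∧ G = φ (upperFacet i)

/-- The prism `Q × [0,1]`. -/
def prism {n : ℕ} (Q : Set (Fin n → ℝ)) : Set ((Fin n → ℝ) × ℝ) :=
  Q ×ˢ Set.Icc (0 : ℝ) 1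

theorem isFace_prism_bottom {n : ℕ} {Q : Set (Fin n → ℝ)} (hQ : Q.Nonempty) :
    IsFace (prism Q) (Q ×ˢ {(0 : ℝ)}) := by
  obtain ⟨q, hq⟩ := hQ
  refine ⟨⟨(q, 0), hq, rfl⟩, fun _ => ⟨-(ContinuousLinearMap.snd ℝ _ _), ?_⟩⟩
  ext ⟨x, t⟩
  simp only [prism, Set.mem_prod, Set.mem_singleton_iff, Set.mem_Icc, Set.mem_ofPred_eq,
    neg_apply, ContinuousLinearMap.coe_snd', Prod.forall]
  constructor
  · rintro ⟨hx, rfl⟩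
    exact ⟨⟨hx, le_rfl, zero_le_one⟩, fun _ s h => by linarith [h.2.1]⟩
  · rintro ⟨⟨hx, h0, _⟩, h⟩
    exact ⟨hx, by linarith [h q 0 ⟨hq, le_rfl, zero_le_one⟩]⟩

theorem isFace_prism_top {n : ℕ} {Q : Set (Fin n → ℝ)} (hQ : Q.Nonempty) :
    IsFace (prism Q) (Q ×ˢ {(1 : ℝ)}) := by
  obtain ⟨q, hq⟩ := hQ
  refine ⟨⟨(q, 1), hq, rfl⟩, fun _ => ⟨ContinuousLinearMap.snd ℝ _ _, ?_⟩⟩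
  ext ⟨x, t⟩
  simp only [prism, Set.mem_prod, Set.mem_singleton_iff, Set.mem_Icc, Set.mem_ofPred_eq,
    ContinuousLinearMap.coe_snd', Prod.forall]
  constructor
  · rintro ⟨hx, rfl⟩
    exact ⟨⟨hx, zero_le_one, le_rfl⟩, fun _ s h => h.2.2⟩
  · rintro ⟨⟨hx, _, h1⟩, h⟩
    exact ⟨hx, le_antisymm h1 (h q 1 ⟨hq, zero_le_one, le_rfl⟩)⟩

/-- The bottom `Q × {0}` of the prism over `Q`. -/
def prismBottom {n : ℕ} {Q : Set (Fin n → ℝ)} (hQ : Q.Nonempty) : FacePoset (prism Q) :=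
  ⟨Q ×ˢ {(0 : ℝ)}, isFace_prism_bottom hQ⟩

/-- The top `Q × {1}` of the prism over `Q`. -/
def prismTop {n : ℕ} {Q : Set (Fin n → ℝ)} (hQ : Q.Nonempty) : FacePoset (prism Q) :=
  ⟨Q ×ˢ {(1 : ℝ)}, isFace_prism_top hQ⟩

/-- A prismatoid: a polytope whose face poset is isomorphic to that of a prism of the same
dimension, such that the faces corresponding to the top and the bottom of the prism are parallel.
An affine isomorphism of polytopes induces an isomorphism of face posets, so it suffices to
compare with the prisms of the form `Q × [0,1]`, `Q` an `n`-dimensional polytope in `ℝ^n`. -/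
def IsPrismatoid {d : ℕ} (P : Set (Fin d → ℝ)) : Prop :=
  IsPolytope P ∧
  ∃ (n : ℕ) (Q : Set (Fin n → ℝ)) (hQ : Q.Nonempty), IsPolytope Q ∧ dim Q = n ∧ n + 1 = dim P ∧
    ∃ φ : FacePoset (prism Q) ≃o FacePoset P,
      Parallel (φ (prismTop hQ) : Set (Fin d → ℝ)) (φ (prismBottom hQ))

end SmoothCube

/-! ### Determinants: principal minors and sign flips. -/

namespace SmoothCube

/-! Label the vertices of $C$ by sign vectors ε. At each vertex the facet functionals `l i (ε i)`
and the primitive edge directions `p ε j` are dual up to positive scaling. Since each `p ε` is a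
lattice basis, `l i b` takes the same value on `p ε i` at every vertex of its facet, so one
rescaling makes the bases exactly dual at all vertices. The endpoints of an edge see it in opposite
primitive directions, so flipping the sign `i` negates `p ε i`, and with it the determinant of the
functionals at ε (`exists_eq_neg_of_dual`).

Write the negated functionals of the facets missing a fixed vertex in the edge basis there. By this
sign rule every principal minor of the resulting matrix is 1. Such a matrix has a row of the
identity (`exists_row_eq_one`): otherwise a minimal cycle of nonzero off-diagonal entries gives a
principal minor differing from 1 by the nonzero product along the cycle, up to sign. That row says
that two opposite functionals are negatives of each other, so their facets are parallel. -/

/-- If all principal minors of a square matrix over a domain are `1`, then one of its rows is the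
corresponding row of the identity matrix. -/
theorem exists_row_eq_one {n R : Type*} [Fintype n] [DecidableEq n] [Nonempty n] [CommRing R]
    [IsDomain R] (A : Matrix n n R)
    (h : ∀ S : Finset n,
      (Matrix.of fun i j => if i ∈ S then A i j else (1 : Matrix n n R) i j).det = 1) :
    ∃ i, A i = (1 : Matrix n n R) i := by
  have hdiag : ∀ i, A i i = 1 := by
    intro i
    rw [← h {i}]
    have : (Matrix.of fun k j => if k ∈ ({i} : Finset n) then A k j else (1 : Matrix n n R) k j)
        = (1 : Matrix n n R).updateRow i (A i) := by
      ext k j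
      by_cases hk : k = i
      · subst hk; simp
      · simp [hk, Matrix.updateRow_ne]
    rw [this, ← Matrix.cramer_transpose_apply, Matrix.transpose_one, Matrix.cramer_one]
    rfl
  by_contra! hne
  have hoff : ∀ i, ∃ j, j ≠ i ∧ A i j ≠ 0 := by
    intro i
    by_contra! hc
    apply hne i
    ext j
    by_cases hj : j = i
    · subst hj; simp [hdiag]
    · rw [hc j hj, Matrix.one_apply_ne (Ne.symm hj)]
  -- Read nonzero off-diagonal entries as arrows of a digraph. A minimal `S` in which every vertex
  -- has an outgoing arrow is a single chordless cycle.
  obtain ⟨S, ⟨hSne, hS⟩, hmin⟩ := exists_minimal_of_wellFoundedLT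
    (fun S : Finset n => S.Nonempty ∧ ∀ i ∈ S, ∃ j ∈ S, j ≠ i ∧ A i j ≠ 0)
    ⟨Finset.univ, Finset.univ_nonempty, fun i _ => by simpa using hoff i⟩
  have key : ∀ f : n → n, (∀ i ∈ S, f i ∈ S ∧ f i ≠ i ∧ A i (f i) ≠ 0) →
      ∀ T ⊆ S, T.Nonempty → (∀ i ∈ T, f i ∈ T) → S ⊆ T := by
    intro f hf T hTS hT hfT
    exact hmin ⟨hT, fun i hi => ⟨f i, hfT i hi, (hf i (hTS hi)).2⟩⟩ hTS
  have hsurj : ∀ f : n → n, (∀ i ∈ S, f i ∈ S ∧ f i ≠ i ∧ A i (f i) ≠ 0) →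
      S.image f = S := by
    intro f hf
    have h1 : S.image f ⊆ S := by
      intro k hk
      obtain ⟨i, hi, rfl⟩ := Finset.mem_image.1 hk
      exact (hf i hi).1
    exact h1.antisymm (key f hf _ h1 (hSne.image f) fun i hi => Finset.mem_image_of_mem f (h1 hi))
  have hinj : ∀ f : n → n, (∀ i ∈ S, f i ∈ S ∧ f i ≠ i ∧ A i (f i) ≠ 0) →
      Set.InjOn f S := fun f hf => Finset.card_image_iff.1 (by rw [hsurj f hf])
  choose! p hpS hp1 hp2 using hS
  have hp : ∀ i ∈ S, p i ∈ S ∧ p i ≠ i ∧ A i (p i) ≠ 0 :=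
    fun i hi => ⟨hpS i hi, hp1 i hi, hp2 i hi⟩
  have huniq : ∀ i ∈ S, ∀ j ∈ S, j ≠ i → A i j ≠ 0 → j = p i := by
    intro i hi j hj hji hA
    by_contra hjp
    obtain ⟨k, hk, hkj⟩ := Finset.mem_image.1 ((hsurj p hp).symm ▸ hj)
    have hki : k ≠ i := by rintro rfl; exact hjp hkj.symm
    -- Redirecting `i` to a second out-neighbour `j = p k` would give a choice of arrows that is not
    -- injective.
    refine hki (hinj (Function.update p i j) ?_ hk hi ?_)
    · intro l hl
      by_cases hli : l = i
      · subst hli; simpa using ⟨hj, hji, hA⟩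
      · simpa [hli] using hp l hl
    · simp [hki, hkj]
  let q : n → n := fun i => if i ∈ S then p i else i
  have hqinj : Function.Injective q := by
    intro i j hij
    by_cases hi : i ∈ S <;> by_cases hj : j ∈ S <;> simp only [q, hi, hj, if_true, if_false] at hij
    · exact hinj p hp hi hj hij
    · exact absurd (hij ▸ hpS i hi) hj
    · exact absurd (hij ▸ hpS j hj) hi
    · exact hij
  let σ : Equiv.Perm n := Equiv.ofBijective q (Finite.injective_iff_bijective.1 hqinj)
  have hσ : ∀ i, σ i = if i ∈ S then p i else i := fun i => rfl
  obtain ⟨s, hs⟩ := hSne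
  have hσ1 : (1 : Equiv.Perm n) ≠ σ := by
    intro h1
    have := hσ s
    rw [← h1, if_pos hs] at this
    exact hp1 s hs this.symm
  have hdet := h S
  -- Only the identity and the cycle σ contribute, so the minor is 1 plus a nonzero term.
  rw [← Matrix.det_transpose, Matrix.det_apply', Fintype.sum_eq_add 1 σ hσ1] at hdet
  · have h1 : ∏ i, (Matrix.of fun i j => if i ∈ S then A i j else (1 : Matrix n n R) i j).transpose
        ((1 : Equiv.Perm n) i) i = 1 :=
      Finset.prod_eq_one fun i _ => by simp [hdiag]
    rw [h1] at hdet
    simp only [Equiv.Perm.sign_one, Units.val_one, Int.cast_one, mul_one, add_eq_left,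
      mul_eq_zero] at hdet
    rcases hdet with hd | hd
    · rcases Int.units_eq_one_or (Equiv.Perm.sign σ) with h' | h' <;> rw [h'] at hd <;> simp at hd
    · obtain ⟨i, -, hi⟩ := Finset.prod_eq_zero_iff.1 hd
      rw [Matrix.transpose_apply, hσ] at hi
      by_cases hiS : i ∈ S
      · simp [hiS, hp2 i hiS] at hi
      · simp [hiS] at hi
  · rintro τ ⟨hτ1, hτσ⟩
    by_contra hτ
    have hτ' : ∀ i, (if i ∈ S then A i (τ i) else (1 : Matrix n n R) i (τ i)) ≠ 0 := fun i hi =>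
      hτ (by rw [Finset.prod_eq_zero (Finset.mem_univ i) (by simpa using hi), mul_zero])
    have hout : ∀ i ∉ S, τ i = i := by
      intro i hi
      have := hτ' i
      rw [if_neg hi] at this
      by_contra hne
      exact this (Matrix.one_apply_ne (Ne.symm hne))
    have hin : ∀ i ∈ S, τ i ≠ i → τ i = p i := by
      intro i hi hne
      refine huniq i hi _ ?_ hne ?_
      · by_contra hc
        exact hne (τ.injective (hout _ hc))
      · simpa [hi] using hτ' i
    -- The set where τ follows the cycle is closed under `p`, hence is empty (τ = 1) or all of `S`
    -- (τ = σ).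
    have hT : ∀ i ∈ S.filter (fun i => τ i = p i), p i ∈ S.filter (fun i => τ i = p i) := by
      intro i hi
      obtain ⟨hi, hiτ⟩ := Finset.mem_filter.1 hi
      refine Finset.mem_filter.2 ⟨hpS i hi, hin _ (hpS i hi) fun hc => hp1 i hi ?_⟩
      exact τ.injective (hc.trans hiτ.symm)
    rcases (S.filter (fun i => τ i = p i)).eq_empty_or_nonempty with h0 | h0
    · apply hτ1
      ext i
      by_cases hi : i ∈ S
      · by_contra hne
        have : i ∈ S.filter (fun i => τ i = p i) := Finset.mem_filter.2 ⟨hi, hin i hi hne⟩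
        simp [h0] at this
      · exact hout i hi
    · apply hτσ
      have := key p hp _ (Finset.filter_subset _ _) h0 hT
      ext i
      rw [hσ]
      by_cases hi : i ∈ S
      · rw [if_pos hi, (Finset.mem_filter.1 (this hi)).2]
      · rw [if_neg hi, hout i hi]

/-- A crosspolytopal family of unimodular dual bases: if `u i (ε i)` and `p ε i` are dual to each
other for all sign vectors `ε`, and flipping the `i`-th sign negates `p ε i`, then two opposite
functionals sum to zero. -/
theorem exists_eq_neg_of_dual {ι : Type*} [Fintype ι] [DecidableEq ι] [Nonempty ι]
    (u : ι → Bool → (ι → ℝ) →ₗ[ℝ] ℝ) (p : (ι → Bool) → ι → ι → ℝ)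
    (hdual : ∀ ε i j, u i (ε i) (p ε j) = (1 : Matrix ι ι ℝ) i j)
    (hflip : ∀ ε i, p (Function.update ε i (!ε i)) i = -p ε i) :
    ∃ i, u i true = -u i false := by
  let U : (ι → Bool) → Matrix ι ι ℝ := fun ε => Matrix.of fun i k => u i (ε i) (Pi.single k 1)
  let P : (ι → Bool) → Matrix ι ι ℝ := fun ε => Matrix.of fun k j => p ε j k
  have hUP : ∀ ε ε' i j, (U ε * P ε') i j = u i (ε i) (p ε' j) := by
    intro ε ε' i j
    rw [Matrix.mul_apply, LinearMap.pi_apply_eq_sum_univ (u i (ε i)) (p ε' j)]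
    refine Finset.sum_congr rfl fun k _ => ?_
    simp only [U, P, Matrix.of_apply, smul_eq_mul, mul_comm]
    congr 2
    ext l
    simp [Pi.single_apply, eq_comm]
  have hone : ∀ ε, U ε * P ε = 1 := fun ε => by
    ext i j
    rw [hUP, hdual]
  have hdet : ∀ ε i, (U (Function.update ε i (!ε i))).det = -(U ε).det := by
    intro ε i
    set ε' := Function.update ε i (!ε i) with hε'
    -- Only row `i` of `U` changes, so the product is the identity outside that row, and its
    -- determinant is the diagonal entry -1.
    have h1 : U ε' * P ε = (1 : Matrix ι ι ℝ).updateRow i ((U ε' * P ε) i) := by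
      ext k j
      by_cases hk : k = i
      · subst hk; simp
      · have : ε' k = ε k := by simp [hε', hk]
        rw [Matrix.updateRow_ne hk, hUP, this, hdual]
    have h2 : (U ε' * P ε).det = -1 := by
      rw [h1, ← Matrix.cramer_transpose_apply, Matrix.transpose_one, Matrix.cramer_one]
      change (U ε' * P ε) i i = -1
      have h3 : p ε i = -p ε' i := by rw [hflip, neg_neg]
      rw [hUP, h3, map_neg, hdual, Matrix.one_apply_eq]
    have h4 : (U ε).det * (P ε).det = 1 := by rw [← Matrix.det_mul, hone, Matrix.det_one]
    rw [Matrix.det_mul] at h2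
    have h5 : (P ε).det ≠ 0 := right_ne_zero_of_mul_eq_one h4
    apply mul_right_cancel₀ h5
    rw [h2, neg_mul, h4]
  let ε₀ : ι → Bool := fun _ => false
  have hsign : ∀ S : Finset ι,
      (U fun i => decide (i ∈ S)).det = (-1) ^ S.card * (U ε₀).det := by
    intro S
    induction S using Finset.induction_on with
    | empty => simp [ε₀]
    | insert i S hi ih =>
      have : (fun j => decide (j ∈ insert i S)) = Function.update (fun j => decide (j ∈ S)) i
          (!(fun j => decide (j ∈ S)) i) := by
        ext j
        by_cases hj : j = i
        · subst hj; simp [hi]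
        · simp [hj]
      rw [this, hdet, ih, Finset.card_insert_of_notMem hi, pow_succ]
      ring
  obtain ⟨i, hi⟩ := exists_row_eq_one
    (Matrix.of fun i j => -u i true (p ε₀ j)) (by
      intro S
      -- The two factors $(-1)^{|S|}$, from the diagonal matrix and from `hsign`, cancel.
      have : (Matrix.of fun i j => if i ∈ S then (Matrix.of fun i j => -u i true (p ε₀ j)) i j
            else (1 : Matrix ι ι ℝ) i j)
          = Matrix.diagonal (fun i => if i ∈ S then (-1 : ℝ) else 1) *
            ((U fun i => decide (i ∈ S)) * P ε₀) := by
        ext i j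
        rw [Matrix.diagonal_mul, hUP]
        by_cases hi : i ∈ S
        · simp [hi]
        · simpa [hi] using (hdual ε₀ i j).symm
      rw [this, Matrix.det_mul, Matrix.det_mul, hsign, Matrix.det_diagonal, Finset.prod_ite_mem,
        Finset.univ_inter, Finset.prod_const, mul_assoc, ← Matrix.det_mul, hone, Matrix.det_one,
        mul_one, ← mul_pow]
      norm_num)
  refine ⟨i, ?_⟩
  have hP : P ε₀ * U ε₀ = 1 := mul_eq_one_comm.1 (hone ε₀)
  have hsum : Matrix.vecMul (U (fun _ => true) i + U ε₀ i) (P ε₀) = 0 := by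
    ext j
    have h1 : (U (fun _ => true) * P ε₀) i j + (U ε₀ * P ε₀) i j = 0 := by
      rw [hUP, hUP, hdual, ← hi]
      simp
    rw [Matrix.add_vecMul]
    exact h1
  have hzero : U (fun _ => true) i + U ε₀ i = 0 := by
    have := congrArg (fun r => Matrix.vecMul r (U ε₀)) hsum
    simpa [Matrix.vecMul_vecMul, hP] using this
  rw [eq_neg_iff_add_eq_zero]
  refine LinearMap.pi_ext' fun k => LinearMap.ext_ring ?_
  exact congrFun hzero k

/-! ### Primitive vectors and lattice bases. -/

theorem toReal_injective {d : ℕ} : Function.Injective (toReal : (Fin d → ℤ) → Fin d → ℝ) :=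
  fun _ _ h => funext fun i => Int.cast_injective (congrFun h i)

theorem toReal_neg {d : ℕ} (u : Fin d → ℤ) : toReal (-u) = -toReal u := by
  ext i; simp [toReal]

theorem toReal_sum_smul {d : ℕ} {ι : Type*} (s : Finset ι) (c : ι → ℤ) (p : ι → Fin d → ℤ) :
    toReal (∑ j ∈ s, c j • p j) = ∑ j ∈ s, (c j : ℝ) • toReal (p j) := by
  ext i; simp [toReal]

/-- The minimality part of the definition of a primitive edge direction. -/
def IsPrimitiveVector {d : ℕ} (u : Fin d → ℤ) : Prop :=
  ∀ (w : Fin d → ℤ) (s : ℝ), 0 < s → toReal w = s • toReal u → 1 ≤ s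

theorem IsPrimitiveVector.eq_of_smul {d : ℕ} {u w : Fin d → ℤ} (hu : IsPrimitiveVector u)
    (hw : IsPrimitiveVector w) {s : ℝ} (hs : 0 < s) (h : toReal w = s • toReal u) : w = u := by
  have h1 := hu w s hs h
  have h2 := hw u s⁻¹ (inv_pos.2 hs) (by rw [h, inv_smul_smul₀ hs.ne'])
  have h3 : s = 1 := le_antisymm ((one_le_inv₀ hs).1 h2) h1
  exact toReal_injective (by rw [h, h3, one_smul])

theorem IsPrimitiveVector.neg {d : ℕ} {u : Fin d → ℤ} (hu : IsPrimitiveVector u) :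
    IsPrimitiveVector (-u) := fun w s hs h =>
  hu (-w) s hs (by rw [toReal_neg, h, toReal_neg, smul_neg, neg_neg])

/-- If the edge directions at all vertices of a cube-like configuration are lattice bases,
then two opposite facet functionals are proportional. -/
theorem exists_eq_smul_of_lattice {d : ℕ} [NeZero d]
    (l : Fin d → Bool → (Fin d → ℝ) →ₗ[ℝ] ℝ) (p : (Fin d → Bool) → Fin d → Fin d → ℤ)
    (hzero : ∀ ε i j, i ≠ j → l i (ε i) (toReal (p ε j)) = 0)
    (hpos : ∀ ε i, 0 < l i (ε i) (toReal (p ε i)))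
    (hspan : ∀ ε, Submodule.span ℤ (Set.range (p ε)) = ⊤)
    (hprim : ∀ ε i, IsPrimitiveVector (p ε i))
    (hanti : ∀ ε i, ∃ s : ℝ, 0 < s ∧
      toReal (p (Function.update ε i (!ε i)) i) = -(s • toReal (p ε i))) :
    ∃ i, ∃ c : ℝ, c ≠ 0 ∧ l i true = c • l i false := by
  have hle : ∀ ε ε' i, ε i = ε' i →
      l i (ε i) (toReal (p ε i)) ≤ l i (ε' i) (toReal (p ε' i)) := by
    intro ε ε' i h
    have hmem : p ε' i ∈ Submodule.span ℤ (Set.range (p ε)) := by rw [hspan]; trivial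
    obtain ⟨c, hc⟩ := (Submodule.mem_span_range_iff_exists_fun ℤ).1 hmem
    -- Only the `i`-th coordinate survives. It is a positive integer, hence at least 1; exchanging
    -- the vertices gives equality.
    have h1 : l i (ε' i) (toReal (p ε' i)) = c i * l i (ε i) (toReal (p ε i)) := by
      rw [← hc, toReal_sum_smul, map_sum, ← h, Finset.sum_eq_single i]
      · simp
      · intro j _ hj
        rw [map_smul, hzero ε i j (Ne.symm hj), smul_zero]
      · simp
    have h2 := hpos ε' i
    have h3 := hpos ε i
    rw [h1] at h2 ⊢
    have h4 : (0 : ℝ) < c i := pos_of_mul_pos_left h2 h3.le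
    have h5 : (1 : ℝ) ≤ c i := by
      have : 0 < c i := by exact_mod_cast h4
      exact_mod_cast this
    exact le_mul_of_one_le_left h3.le h5
  let m : Fin d → Bool → ℝ := fun i b => l i b (toReal (p (fun _ => b) i))
  have hm : ∀ i b, 0 < m i b := fun i b => hpos (fun _ => b) i
  have hmε : ∀ ε i, l i (ε i) (toReal (p ε i)) = m i (ε i) := fun ε i =>
    le_antisymm (hle ε (fun _ => ε i) i rfl) (hle (fun _ => ε i) ε i rfl)
  obtain ⟨i, hi⟩ := exists_eq_neg_of_dual (fun i b => (m i b)⁻¹ • l i b)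
    (fun ε i => toReal (p ε i)) (by
      intro ε i j
      by_cases hij : i = j
      · subst hij
        simp [hmε, (hm i (ε i)).ne']
      · simp [hzero ε i j hij, Matrix.one_apply_ne hij]) (by
      intro ε i
      obtain ⟨s, hs, h⟩ := hanti ε i
      rw [← toReal_neg]
      congr 1
      exact (hprim ε i).neg.eq_of_smul (hprim _ i) hs (by rw [h, toReal_neg, smul_neg]))
  refine ⟨i, -(m i true * (m i false)⁻¹), ?_, ?_⟩
  · exact neg_ne_zero.2 (mul_ne_zero (hm i true).ne' (inv_ne_zero (hm i false).ne'))
  · have := congrArg (fun f => m i true • f) hi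
    simp only [smul_inv_smul₀ (hm i true).ne'] at this
    rw [this]
    module

/-! ### Faces, supporting functionals and dimension. -/

section General

variable {E : Type*} [AddCommGroup E] [Module ℝ E]

theorem lin_mono {F G : Set E} (h : F ⊆ G) : lin F ≤ lin G := vectorSpan_mono ℝ h

theorem lin_le_ker {F : Set E} {l : E →ₗ[ℝ] ℝ} {c : ℝ} (h : ∀ x ∈ F, l x = c) :
    lin F ≤ LinearMap.ker l := by
  rw [lin, vectorSpan, Submodule.span_le]
  rintro _ ⟨x, hx, y, hy, rfl⟩
  simp [h x hx, h y hy]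

theorem exists_eq_singleton_of_dim_eq_zero [FiniteDimensional ℝ E] {F : Set E} (hF : F.Nonempty)
    (h : dim F = 0) : ∃ v, F = {v} := by
  obtain ⟨v, hv⟩ := hF
  refine ⟨v, Set.eq_singleton_iff_unique_mem.2 ⟨hv, fun x hx => ?_⟩⟩
  have h1 : x - v ∈ lin F := vsub_mem_vectorSpan ℝ hx hv
  rw [Submodule.finrank_eq_zero.1 h, Submodule.mem_bot, sub_eq_zero] at h1
  exact h1

theorem exists_sub_eq_smul_of_dim_eq_one {F : Set E} (h : dim F = 1) {v w : E}
    (hv : v ∈ F) (hw : w ∈ F) (hvw : w ≠ v) {x : E} (hx : x ∈ F) :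
    ∃ t : ℝ, x - v = t • (w - v) := by
  have h1 : w - v ∈ lin F := vsub_mem_vectorSpan ℝ hw hv
  have h2 : x - v ∈ lin F := vsub_mem_vectorSpan ℝ hx hv
  obtain ⟨t, ht⟩ := (finrank_eq_one_iff_of_nonzero' (⟨w - v, h1⟩ : lin F)
    (by simpa [Subtype.ext_iff, sub_eq_zero] using hvw)).1 h ⟨x - v, h2⟩
  exact ⟨t, by simpa using (congrArg Subtype.val ht).symm⟩

variable [TopologicalSpace E]

theorem IsFace.subset {P F : Set E} (h : IsFace P F) : F ⊆ P := h.2.subset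

/-- A face is cut out by a linear functional that attains its minimum there. -/
theorem IsFace.exists_functional {P F : Set E} (h : IsFace P F) :
    ∃ (l : E →ₗ[ℝ] ℝ) (c : ℝ), (∀ x ∈ F, l x = c) ∧ ∀ x ∈ P, x ∉ F → c < l x := by
  obtain ⟨⟨y, hy⟩, hF⟩ := h
  obtain ⟨l, hl⟩ := hF ⟨y, hy⟩
  have hF' : ∀ x, x ∈ F ↔ x ∈ P ∧ ∀ z ∈ P, l z ≤ l x := fun x => by rw [hl]; rfl
  refine ⟨-l.toLinearMap, -l y, fun x hx => ?_, fun x hx hxF => ?_⟩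
  · have h1 := ((hF' x).1 hx).2 y ((hF' y).1 hy).1
    have h2 := ((hF' y).1 hy).2 x ((hF' x).1 hx).1
    simpa using le_antisymm h2 h1
  · have h1 := ((hF' y).1 hy).2 x hx
    have h2 : l x ≠ l y := fun h3 =>
      hxF ((hF' x).2 ⟨hx, fun z hz => by rw [h3]; exact ((hF' y).1 hy).2 z hz⟩)
    simpa using lt_of_le_of_ne h1 h2

/-- A functional exposing `F` is constant on `F` but not on `G`, so it kills `lin F` and not `lin
G`. -/
theorem dim_lt_dim [FiniteDimensional ℝ E] {P F G : Set E} (hF : IsFace P F) (hG : IsFace P G)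
    (h : F ⊂ G) : dim F < dim G := by
  obtain ⟨l, c, hc, hlt⟩ := hF.exists_functional
  obtain ⟨x, hxG, hxF⟩ := Set.exists_of_ssubset h
  obtain ⟨y, hy⟩ := hF.1
  refine Submodule.finrank_lt_finrank_of_lt (lt_of_le_of_ne (lin_mono h.1) fun heq => ?_)
  have h1 : x - y ∈ lin G := vsub_mem_vectorSpan ℝ hxG (h.1 hy)
  rw [← heq] at h1
  have h2 := lin_le_ker hc h1
  rw [LinearMap.mem_ker, map_sub, hc y hy, sub_eq_zero] at h2
  exact (hlt x (hG.subset hxG) hxF).ne' h2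

end General

/-! ### Faces of the unit cube. -/

/-- The vertex of the unit cube with the given coordinates. -/
def cubeVertex {d : ℕ} (ε : Fin d → Bool) : Fin d → ℝ := fun i => if ε i then 1 else 0

/-- The face of the unit cube spanned by the directions in `T` at the vertex `ε`. -/
def cubeFaceSet {d : ℕ} (ε : Fin d → Bool) (T : Finset (Fin d)) : Set (Fin d → ℝ) :=
  {x | x ∈ unitCube d ∧ ∀ j ∉ T, x j = cubeVertex ε j}

theorem cubeVertex_mem_cubeFaceSet {d : ℕ} {ε ε' : Fin d → Bool} {T : Finset (Fin d)} :
    cubeVertex ε' ∈ cubeFaceSet ε T ↔ ∀ j ∉ T, ε' j = ε j := by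
  constructor
  · intro h j hj
    have := h.2 j hj
    cases h1 : ε j <;> cases h2 : ε' j <;> simp_all [cubeVertex]
  · refine fun h => ⟨fun k => ?_, fun j hj => by simp [cubeVertex, h j hj]⟩
    cases h1 : ε' k <;> simp [cubeVertex, h1]

theorem isFace_cubeFaceSet {d : ℕ} (ε : Fin d → Bool) (T : Finset (Fin d)) :
    IsFace (unitCube d) (cubeFaceSet ε T) := by
  have hv : cubeVertex ε ∈ cubeFaceSet ε T := cubeVertex_mem_cubeFaceSet.2 fun _ _ => rfl
  -- Each coordinate outside `T` is pushed towards its value at the vertex; termwise maximality then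
  -- forces equality there.
  let a : Fin d → ℝ := fun j => if j ∈ T then 0 else if ε j then 1 else -1
  have hterm : ∀ x ∈ unitCube d, ∀ j, a j * x j ≤ a j * cubeVertex ε j := by
    intro x hx j
    have := hx j
    by_cases hj : j ∈ T <;> cases h : ε j <;> simp [a, hj, h, cubeVertex, this]
  let l : (Fin d → ℝ) →L[ℝ] ℝ := ∑ j, a j • ContinuousLinearMap.proj j
  have hl : ∀ x, l x = ∑ j, a j * x j := fun x => by simp [l]
  refine ⟨⟨_, hv⟩, fun _ => ⟨l, ?_⟩⟩
  ext x
  simp only [Set.mem_ofPred_eq, hl]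
  constructor
  · rintro ⟨hx, h⟩
    refine ⟨hx, fun y hy => Finset.sum_le_sum fun j _ => (hterm y hy j).trans (le_of_eq ?_)⟩
    by_cases hj : j ∈ T
    · simp [a, hj]
    · rw [h j hj]
  · rintro ⟨hx, h⟩
    refine ⟨hx, fun j hj => ?_⟩
    have h1 := le_antisymm (Finset.sum_le_sum fun j _ => hterm x hx j) (h _ hv.1)
    have h2 := (Finset.sum_eq_sum_iff_of_le fun j _ => hterm x hx j).1 h1 j (Finset.mem_univ j)
    refine mul_left_cancel₀ ?_ h2
    cases hε : ε j <;> simp [a, hj, hε]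

/-- `cubeFaceSet` as an element of the face poset. -/
def cubeFace {d : ℕ} (ε : Fin d → Bool) (T : Finset (Fin d)) : FacePoset (unitCube d) :=
  ⟨cubeFaceSet ε T, isFace_cubeFaceSet ε T⟩

theorem cubeFace_mono {d : ℕ} (ε : Fin d → Bool) {S T : Finset (Fin d)} (h : S ⊆ T) :
    cubeFace ε S ≤ cubeFace ε T :=
  fun _ hx => ⟨hx.1, fun j hj => hx.2 j fun hS => hj (h hS)⟩

theorem cubeFace_le_iff {d : ℕ} (ε : Fin d → Bool) {S T : Finset (Fin d)} :
    cubeFace ε S ≤ cubeFace ε T ↔ S ⊆ T := by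
  refine ⟨fun h i hi => ?_, cubeFace_mono ε⟩
  by_contra hT
  have h1 : cubeVertex (Function.update ε i (!ε i)) ∈ cubeFaceSet ε S :=
    cubeVertex_mem_cubeFaceSet.2 fun j hj => by
      rw [Function.update_of_ne]
      rintro rfl
      exact hj hi
  have := cubeVertex_mem_cubeFaceSet.1 (h h1) i hT
  simp at this

theorem cubeFace_lt {d : ℕ} (ε : Fin d → Bool) {S T : Finset (Fin d)} (h : S ⊂ T) :
    cubeFace ε S < cubeFace ε T := by
  rw [lt_iff_le_not_ge, cubeFace_le_iff, cubeFace_le_iff]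
  exact ⟨h.1, h.2⟩

theorem cubeFaceSet_empty {d : ℕ} (ε : Fin d → Bool) : cubeFaceSet ε ∅ = {cubeVertex ε} := by
  refine Set.eq_singleton_iff_unique_mem.2
    ⟨cubeVertex_mem_cubeFaceSet.2 fun _ _ => rfl, fun x hx => ?_⟩
  ext j
  exact hx.2 j (Finset.notMem_empty j)

theorem cubeFace_empty_le_iff {d : ℕ} {ε : Fin d → Bool} {F : FacePoset (unitCube d)} :
    cubeFace ε ∅ ≤ F ↔ cubeVertex ε ∈ F.1 := by
  rw [← Subtype.coe_le_coe]
  change cubeFaceSet ε ∅ ⊆ _ ↔ _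
  rw [cubeFaceSet_empty, Set.singleton_subset_iff]

/-- The facet `x i = 0` or `x i = 1` of the unit cube. -/
def cubeFacet {d : ℕ} (i : Fin d) (b : Bool) : FacePoset (unitCube d) :=
  if b then upperFacet i else lowerFacet i

theorem mem_cubeFacet {d : ℕ} {i : Fin d} {b : Bool} {x : Fin d → ℝ} :
    x ∈ (cubeFacet i b).1 ↔ x ∈ unitCube d ∧ x i = if b then 1 else 0 := by
  cases b <;> simp [cubeFacet, lowerFacet, upperFacet]

theorem cubeVertex_mem_cubeFacet {d : ℕ} {i : Fin d} {b : Bool} {ε : Fin d → Bool} :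
    cubeVertex ε ∈ (cubeFacet i b).1 ↔ ε i = b := by
  have h : cubeVertex ε ∈ unitCube d :=
    ((cubeVertex_mem_cubeFaceSet (T := ∅) (ε := ε)).2 fun _ _ => rfl).1
  rw [mem_cubeFacet]
  cases h1 : ε i <;> cases b <;> simp [cubeVertex, h1, h]

theorem cubeFacet_eq_cubeFace {d : ℕ} (i : Fin d) (ε : Fin d → Bool) :
    cubeFacet i (ε i) = cubeFace ε {i}ᶜ := by
  apply Subtype.ext
  ext x
  rw [mem_cubeFacet]
  simp [cubeFace, cubeFaceSet, cubeVertex]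

/-! ### Dimensions in a combinatorial cube. -/

section CombinatorialCube

variable {d : ℕ} {C : Set (Fin d → ℝ)}

/-- An isomorphism of face posets from the unit cube preserves the dimension of faces. -/
theorem dim_map_cubeFace (hdim : dim C = d) (φ : FacePoset (unitCube d) ≃o FacePoset C)
    (ε : Fin d → Bool) (T : Finset (Fin d)) : dim (φ (cubeFace ε T)).1 = T.card := by
  have hlt : ∀ {S T : Finset (Fin d)}, S ⊂ T →
      dim (φ (cubeFace ε S)).1 < dim (φ (cubeFace ε T)).1 := fun {S T} h =>
    dim_lt_dim (φ (cubeFace ε S)).2 (φ (cubeFace ε T)).2 (φ.strictMono (cubeFace_lt ε h))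
  have hins : ∀ (S : Finset (Fin d)) (i : Fin d), i ∉ S →
      dim (φ (cubeFace ε S)).1 < dim (φ (cubeFace ε (insert i S))).1 := fun S i hi =>
    hlt (Finset.ssubset_insert hi)
  -- Dimension strictly increases along chains. Climbing from the vertex bounds it below, descending
  -- from the whole polytope bounds it above, and the bounds meet.
  have hlow : ∀ T : Finset (Fin d), T.card ≤ dim (φ (cubeFace ε T)).1 := by
    intro T
    induction T using Finset.induction_on with
    | empty => simp
    | insert i T hi ih =>
      rw [Finset.card_insert_of_notMem hi]
      exact lt_of_le_of_lt ih (hins T i hi)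
  have hup : ∀ T : Finset (Fin d), dim (φ (cubeFace ε Tᶜ)).1 + T.card ≤ d := by
    intro T
    induction T using Finset.induction_on with
    | empty =>
      have : dim (φ (cubeFace ε ∅ᶜ)).1 ≤ dim C :=
        Submodule.finrank_mono (lin_mono (φ (cubeFace ε ∅ᶜ)).2.subset)
      simpa [hdim] using this
    | insert i T hi ih =>
      have h1 : (insert i T)ᶜ ⊂ Tᶜ := by
        rw [compl_lt_compl_iff_lt]
        exact Finset.ssubset_insert hi
      have := hlt h1
      rw [Finset.card_insert_of_notMem hi]
      omega
  have h1 := hup Tᶜ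
  have h2 := Finset.card_add_card_compl T
  rw [compl_compl] at h1
  rw [Fintype.card_fin] at h2
  have := hlow T
  omega

theorem isFacet_map_cubeFacet (hdim : dim C = d) (φ : FacePoset (unitCube d) ≃o FacePoset C)
    (i : Fin d) (b : Bool) : IsFacet C (φ (cubeFacet i b)).1 := by
  refine ⟨(φ (cubeFacet i b)).2, ?_⟩
  have h := dim_map_cubeFace hdim φ (fun _ => b) {i}ᶜ
  rw [← cubeFacet_eq_cubeFace, Finset.card_compl, Fintype.card_fin, Finset.card_singleton] at h
  have := i.pos
  rw [h, hdim]
  omega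

theorem lin_map_cubeFacet (hdim : dim C = d) (φ : FacePoset (unitCube d) ≃o FacePoset C)
    (i : Fin d) (b : Bool) {l : (Fin d → ℝ) →ₗ[ℝ] ℝ} (hl : l ≠ 0) {c : ℝ}
    (hc : ∀ x ∈ (φ (cubeFacet i b)).1, l x = c) :
    lin (φ (cubeFacet i b)).1 = LinearMap.ker l := by
  refine Submodule.eq_of_le_of_finrank_eq (lin_le_ker hc) ?_
  have h1 := (isFacet_map_cubeFacet hdim φ i b).2
  have h2 := Module.Dual.finrank_ker_add_one_of_ne_zero (f := l) hl
  rw [Module.finrank_fin_fun] at h2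
  rw [hdim, dim] at h1
  omega

end CombinatorialCube

/-! ### From smoothness to parallel facets. -/

theorem exists_lin_eq_of_smooth {d : ℕ} [NeZero d] {C : Set (Fin d → ℝ)} (hdim : dim C = d)
    (hsmooth : IsSmooth C) (φ : FacePoset (unitCube d) ≃o FacePoset C) :
    ∃ i, lin (φ (cubeFacet i true)).1 = lin (φ (cubeFacet i false)).1 := by
  have hvex : ∀ ε : Fin d → Bool, ∃ v, (φ (cubeFace ε ∅)).1 = {v} := fun ε =>
    exists_eq_singleton_of_dim_eq_zero (φ (cubeFace ε ∅)).2.1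
      (by rw [dim_map_cubeFace hdim, Finset.card_empty])
  choose v hv using hvex
  have hvmem : ∀ ε F, v ε ∈ (φ F).1 ↔ cubeVertex ε ∈ F.1 := fun ε F => by
    rw [← cubeFace_empty_le_iff, ← φ.le_iff_le, ← Subtype.coe_le_coe, hv]
    exact Set.singleton_subset_iff.symm
  have hvert : ∀ ε, IsVertex C (v ε) := fun ε => by
    rw [IsVertex, ← hv]
    exact (φ (cubeFace ε ∅)).2
  have hvC : ∀ ε, v ε ∈ C := fun ε => (hvert ε).subset rfl
  choose l c hlc hlt using fun (i : Fin d) (b : Bool) =>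
    (φ (cubeFacet i b)).2.exists_functional
  have hleC : ∀ i b, ∀ x ∈ C, c i b ≤ l i b x := fun i b x hx => by
    by_cases h : x ∈ (φ (cubeFacet i b)).1
    · exact (hlc i b x h).ge
    · exact (hlt i b x hx h).le
  have hveq : ∀ i b ε, ε i = b → l i b (v ε) = c i b := fun i b ε h =>
    hlc i b _ ((hvmem _ _).2 (cubeVertex_mem_cubeFacet.2 h))
  have hvlt : ∀ i b ε, ε i ≠ b → c i b < l i b (v ε) := fun i b ε h =>
    hlt i b _ (hvC ε) fun hm => h (cubeVertex_mem_cubeFacet.1 ((hvmem _ _).1 hm))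
  let e : (Fin d → Bool) → Fin d → Fin d → ℝ := fun ε i =>
    v (Function.update ε i (!ε i)) - v ε
  have he0 : ∀ ε i j, i ≠ j → l i (ε i) (e ε j) = 0 := fun ε i j hij => by
    rw [map_sub, hveq i _ ε rfl, hveq i _ _ (by simp [hij]), sub_self]
  have hepos : ∀ ε i, 0 < l i (ε i) (e ε i) := fun ε i => by
    rw [map_sub, hveq i _ ε rfl, sub_pos]
    exact hvlt i _ _ (by simp)
  -- The images of the `d` cube edges are edges at the vertex; simplicity leaves no others.
  have hedges : ∀ ε, Set.range (fun i => (φ (cubeFace ε {i})).1)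
      = {F | IsEdge C F ∧ v ε ∈ F} := by
    intro ε
    have hcard := hsmooth.1 (v ε) (hvert ε)
    rw [hdim] at hcard
    refine Set.eq_of_subset_of_ncard_le ?_ ?_
      (Set.finite_of_ncard_pos (by rw [hcard]; exact NeZero.pos d))
    · rintro _ ⟨i, rfl⟩
      refine ⟨⟨(φ (cubeFace ε {i})).2, ?_⟩, ?_⟩
      · rw [dim_map_cubeFace hdim, Finset.card_singleton]
      · exact (hvmem _ _).2 (cubeVertex_mem_cubeFaceSet.2 fun _ _ => rfl)
    · have hinj : Function.Injective (fun i => (φ (cubeFace ε {i})).1) := by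
        intro i j hij
        have h1 := (cubeFace_le_iff ε).1 (φ.injective (Subtype.ext hij)).le
        simpa using h1
      rw [hcard, ← Set.image_univ, Set.ncard_image_of_injective _ hinj, Set.ncard_univ,
        Nat.card_fin]
  have hdir : ∀ ε u, IsPrimitiveEdgeDirection C (v ε) u →
      ∃ i, ∃ r : ℝ, 0 < r ∧ toReal u = r • e ε i := by
    rintro ε u ⟨hu0, ⟨F, hF, hvF, t, ht, htF⟩, -⟩
    have hmem : F ∈ {F | IsEdge C F ∧ v ε ∈ F} := ⟨hF, hvF⟩
    rw [← hedges] at hmem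
    obtain ⟨i, rfl⟩ := hmem
    have hne : v (Function.update ε i (!ε i)) ≠ v ε := fun h => by
      have := hepos ε i
      simp [e, h] at this
    obtain ⟨s, hs⟩ := exists_sub_eq_smul_of_dim_eq_one hF.2 hvF
      ((hvmem _ _).2 (cubeVertex_mem_cubeFaceSet.2 fun j hj =>
        Function.update_of_ne (by simpa using hj) _ _)) hne htF
    rw [add_sub_cancel_left] at hs
    change _ = s • e ε i at hs
    have hu : toReal u = (t⁻¹ * s) • e ε i := by rw [mul_smul, ← hs, inv_smul_smul₀ ht.ne']
    have hs0 : s ≠ 0 := by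
      rintro rfl
      rw [mul_zero, zero_smul] at hu
      exact hu0 (toReal_injective (hu.trans (by ext; simp [toReal])))
    -- The edge stays in `C`, on the nonnegative side of facet `i`.
    have hs1 : 0 ≤ s := by
      have h1 := hleC i (ε i) _ (hF.1.subset htF)
      rw [map_add, hveq i _ ε rfl, hs, map_smul, smul_eq_mul] at h1
      exact nonneg_of_mul_nonneg_left (by linarith) (hepos ε i)
    exact ⟨i, _, mul_pos (inv_pos.2 ht) (lt_of_le_of_ne hs1 hs0.symm), hu⟩
  have hex : ∀ ε i, ∃ u, IsPrimitiveEdgeDirection C (v ε) u ∧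
      ∃ r : ℝ, 0 < r ∧ toReal u = r • e ε i := by
    intro ε i
    by_contra! hcon
    -- Without a primitive direction along edge `i`, the functional of facet `i` would vanish on all
    -- primitive directions, hence on the lattice they span.
    let f : (Fin d → ℤ) →ₗ[ℤ] ℝ :=
      (l i (ε i)).toAddMonoidHom.toIntLinearMap.comp
        ((Int.castAddHom ℝ).toIntLinearMap.compLeft (Fin d))
    have hf : ∀ u, f u = l i (ε i) (toReal u) := fun u => rfl
    have hf0 : f = 0 := by
      refine LinearMap.ext_on (hsmooth.2 (v ε) (hvert ε)).2 fun u hu => ?_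
      obtain ⟨j, r, hr, hur⟩ := hdir ε u hu
      have hij : i ≠ j := by
        rintro rfl
        exact hcon u hu r hr hur
      rw [hf, hur, map_smul, he0 ε i j hij, smul_zero, LinearMap.zero_apply]
    have hl0 : l i (ε i) = 0 := by
      refine LinearMap.pi_ext' fun k => LinearMap.ext_ring ?_
      have := hf (Pi.single k 1)
      rw [hf0] at this
      have h1 : toReal (Pi.single k 1) = (Pi.single k 1 : Fin d → ℝ) := by
        ext m
        by_cases hm : m = k
        · subst hm; simp [toReal]
        · simp [toReal, hm]
      rw [h1] at this
      exact this.symm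
    have := hepos ε i
    rw [hl0] at this
    exact lt_irrefl _ this
  choose p hp r hr hpr using hex
  have hprim : ∀ ε i, IsPrimitiveVector (p ε i) := fun ε i => (hp ε i).2.2
  have hrange : ∀ ε, Set.range (p ε) = {u | IsPrimitiveEdgeDirection C (v ε) u} := by
    intro ε
    refine Set.Subset.antisymm (Set.range_subset_iff.2 (hp ε)) fun u hu => ?_
    obtain ⟨i, s, hs, hus⟩ := hdir ε u hu
    refine ⟨i, IsPrimitiveVector.eq_of_smul hu.2.2 (hprim ε i) (mul_pos (hr ε i) (inv_pos.2 hs)) ?_⟩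
    rw [hpr, hus, mul_smul, inv_smul_smul₀ hs.ne']
  obtain ⟨i, k, hk, hlk⟩ := exists_eq_smul_of_lattice l p
    (fun ε i j hij => by rw [hpr, map_smul, he0 ε i j hij, smul_zero])
    (fun ε i => by rw [hpr, map_smul]; exact smul_pos (hr ε i) (hepos ε i))
    (fun ε => by rw [hrange]; exact (hsmooth.2 (v ε) (hvert ε)).2) hprim
    -- Flipping the sign `i` swaps the endpoints of the edge, so `e` changes sign.
    (fun ε i => by
      refine ⟨r (Function.update ε i (!ε i)) i * (r ε i)⁻¹,
        mul_pos (hr _ i) (inv_pos.2 (hr ε i)), ?_⟩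
      rw [hpr, hpr, mul_smul, inv_smul_smul₀ (hr ε i).ne', ← smul_neg]
      simp [e])
  have hl0 : ∀ b, l i b ≠ 0 := fun b h => by
    have := hepos (fun _ => b) i
    simp [h] at this
  refine ⟨i, ?_⟩
  rw [lin_map_cubeFacet hdim φ i true (hl0 true) (hlc i true),
    lin_map_cubeFacet hdim φ i false (hl0 false) (hlc i false), hlk, LinearMap.ker_smul _ _ hk]

/-! ### The cube as a prism over a smaller cube. -/

theorem IsFace.preimage {E F : Type*} [AddCommGroup E] [Module ℝ E] [TopologicalSpace E]
    [AddCommGroup F] [Module ℝ F] [TopologicalSpace F] (e : E ≃L[ℝ] F) {P : Set E} {P' : Set F}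
    (h : ∀ x, e x ∈ P' ↔ x ∈ P) {G : Set F} (hG : IsFace P' G) : IsFace P (e ⁻¹' G) := by
  obtain ⟨⟨y, hy⟩, hexp⟩ := hG
  obtain ⟨l, hl⟩ := hexp ⟨y, hy⟩
  refine ⟨⟨e.symm y, by simpa using hy⟩, fun _ => ⟨l.comp (e : E →L[ℝ] F), ?_⟩⟩
  ext x
  rw [hl]
  simp only [Set.mem_preimage, Set.mem_ofPred_eq, h, ContinuousLinearMap.comp_apply,
    ContinuousLinearEquiv.coe_coe]
  refine and_congr_right fun _ => ⟨fun H z hz => H _ ((h z).2 hz), fun H z hz => ?_⟩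
  have := H (e.symm z) ((h _).1 (by simpa using hz))
  simpa using this

/-- Linearly isomorphic sets have isomorphic face posets. -/
def facePosetCongr {E F : Type*} [AddCommGroup E] [Module ℝ E] [TopologicalSpace E]
    [AddCommGroup F] [Module ℝ F] [TopologicalSpace F] (e : E ≃L[ℝ] F) {P : Set E} {P' : Set F}
    (h : ∀ x, e x ∈ P' ↔ x ∈ P) : FacePoset P ≃o FacePoset P' where
  toFun G := ⟨e.symm ⁻¹' G.1, G.2.preimage e.symm fun x => by rw [← h]; simp⟩
  invFun G := ⟨e ⁻¹' G.1, G.2.preimage e h⟩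
  left_inv G := Subtype.ext (by ext; simp)
  right_inv G := Subtype.ext (by ext; simp)
  map_rel_iff' {G H} := by
    change e.symm ⁻¹' G.1 ⊆ e.symm ⁻¹' H.1 ↔ G.1 ⊆ H.1
    exact e.symm.surjective.preimage_subset_preimage_iff

theorem unitCube_eq_pi (d : ℕ) : unitCube d = Set.univ.pi fun _ => Set.Icc 0 1 := by
  ext x
  simp only [unitCube, Set.mem_pi, Set.mem_univ, Set.mem_Icc, true_imp_iff]
  rfl

theorem isPolytope_unitCube (d : ℕ) : IsPolytope (unitCube d) := by
  refine ⟨Set.univ.pi fun _ => {0, 1}, Set.Finite.pi fun _ => Set.toFinite _,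
    ⟨0, by simp⟩, ?_⟩
  rw [convexHull_pi, unitCube_eq_pi]
  simp [convexHull_pair, segment_eq_Icc]

theorem dim_unitCube (d : ℕ) : dim (unitCube d) = d := by
  have h : lin (unitCube d) = ⊤ := by
    rw [eq_top_iff, ← (Pi.basisFun ℝ (Fin d)).span_eq, Submodule.span_le]
    rintro _ ⟨i, rfl⟩
    have h0 : (0 : Fin d → ℝ) ∈ unitCube d := fun k => by simp
    have h1 : (Pi.single i 1 : Fin d → ℝ) ∈ unitCube d := fun k => by
      by_cases hk : k = i
      · subst hk; simp
      · simp [hk]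
    simpa [lin] using vsub_mem_vectorSpan ℝ h1 h0
  rw [dim, h, finrank_top, Module.finrank_fin_fun]

/-- Insertion of a coordinate, as a linear isomorphism. -/
noncomputable def insertCoord {n : ℕ} (i : Fin (n + 1)) :
    ((Fin n → ℝ) × ℝ) ≃L[ℝ] (Fin (n + 1) → ℝ) :=
  LinearEquiv.toContinuousLinearEquiv
    { toFun := fun x => i.insertNth x.2 x.1
      invFun := fun y => (i.removeNth y, y i)
      map_add' := fun x y => by
        rw [Prod.fst_add, Prod.snd_add, Fin.insertNth_add]
      map_smul' := fun c x => by
        ext j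
        refine Fin.succAboveCases i ?_ (fun k => ?_) j <;> simp
      left_inv := fun x => by simp
      right_inv := fun y => by simp }

theorem insertCoord_mem {n : ℕ} (i : Fin (n + 1)) (x : (Fin n → ℝ) × ℝ) :
    insertCoord i x ∈ unitCube (n + 1) ↔ x ∈ prism (unitCube n) := by
  change (∀ k, 0 ≤ i.insertNth (α := fun _ => ℝ) x.2 x.1 k ∧
    i.insertNth (α := fun _ => ℝ) x.2 x.1 k ≤ 1) ↔ (∀ k, 0 ≤ x.1 k ∧ x.1 k ≤ 1) ∧ 0 ≤ x.2 ∧ x.2 ≤ 1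
  rw [Fin.forall_iff_succAbove i]
  simp [and_comm]

/-- Placing the interval factor in coordinate `i` lets the parallel pair become the top and bottom,
whichever `i` occurs. -/
theorem mem_facePosetCongr_insertCoord {n : ℕ} (i : Fin (n + 1)) (t : ℝ)
    (h : IsFace (prism (unitCube n)) (unitCube n ×ˢ {t})) (ht : t ∈ Set.Icc (0 : ℝ) 1) :
    (facePosetCongr (insertCoord i) (insertCoord_mem i) ⟨_, h⟩).1 =
      {x | x ∈ unitCube (n + 1) ∧ x i = t} := by
  ext x
  obtain ⟨y, rfl⟩ := (insertCoord i).surjective x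
  have h1 : insertCoord i y i = y.2 := Fin.insertNth_apply_same (α := fun _ => ℝ) i y.2 y.1
  change (insertCoord i).symm (insertCoord i y) ∈ unitCube n ×ˢ {t} ↔
    insertCoord i y ∈ unitCube (n + 1) ∧ insertCoord i y i = t
  rw [insertCoord_mem, h1, ContinuousLinearEquiv.symm_apply_apply, prism, Set.mem_prod,
    Set.mem_prod, Set.mem_singleton_iff]
  refine ⟨fun ⟨hy, hyt⟩ => ⟨⟨hy, hyt ▸ ht⟩, hyt⟩, fun ⟨hy, hyt⟩ => ⟨hy.1, hyt⟩⟩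

end SmoothCube

theorem mainTheorem3 (d : ℕ) (hd : 2 ≤ d) (C : Set (Fin d → ℝ))
    (hC : SmoothCube.IsCombinatorialCube d C) (hsmooth : SmoothCube.IsSmooth C) :
    (∀ φ : SmoothCube.FacePoset (SmoothCube.unitCube d) ≃o SmoothCube.FacePoset C,
      ∃ F G : Set (Fin d → ℝ), SmoothCube.AreOpposite φ F G ∧ SmoothCube.Parallel F G) ∧
    SmoothCube.IsPrismatoid C := by
  open SmoothCube in
  obtain ⟨hpoly, hdim, ⟨φ₀⟩⟩ := hC
  have : NeZero d := ⟨by omega⟩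
  refine ⟨fun φ => ?_, hpoly, ?_⟩
  · obtain ⟨i, hi⟩ := exists_lin_eq_of_smooth hdim hsmooth φ
    exact ⟨_, _, ⟨isFacet_map_cubeFacet hdim φ i false, isFacet_map_cubeFacet hdim φ i true,
      i, rfl, rfl⟩, hi.symm⟩
  · obtain ⟨i, hi⟩ := exists_lin_eq_of_smooth hdim hsmooth φ₀
    obtain ⟨n, rfl⟩ : ∃ n, d = n + 1 := ⟨d - 1, by omega⟩
    have hne : (unitCube n).Nonempty := ⟨0, fun k => by simp⟩
    refine ⟨n, unitCube n, hne, isPolytope_unitCube n, dim_unitCube n, hdim.symm,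
      (facePosetCongr (insertCoord i) (insertCoord_mem i)).trans φ₀, ?_⟩
    have htop : facePosetCongr (insertCoord i) (insertCoord_mem i) (prismTop hne) =
        cubeFacet i true :=
      Subtype.ext (mem_facePosetCongr_insertCoord i 1 _ ⟨zero_le_one, le_rfl⟩)
    have hbot : facePosetCongr (insertCoord i) (insertCoord_mem i) (prismBottom hne) =
        cubeFacet i false :=
      Subtype.ext (mem_facePosetCongr_insertCoord i 0 _ ⟨le_rfl, zero_le_one⟩)
    rw [Parallel, OrderIso.trans_apply, OrderIso.trans_apply, htop, hbot]
    exact hi
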